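/- For positive integers $n,d$ let $[n]=\{1,\dots,n\}$. A function $f:[n]^d\to\mathbb R$ is unate if for every coordinate $i\in\{1,\dots,d\}$ it is either nondecreasing in coordinate $i$ or nonincreasing in coordinate $i$; it is $\varepsilon$-far from unate if every unate function $g:[n]^d\to\mathbb R$ differs from $f$ on at least $\varepsilon n^d$ points. A unateness tester with distance parameter $\varepsilon$ is a randomized, possibly adaptive, algorithm with query access to $f:[n]^d\to\mathbb R$ that accepts with probability at least $2/3$ if $f$ is unate and rejects with probability at least $2/3$ if $f$ is $\varepsilon$-far from unate. Theorem. Any unateness tester for functions $f:[n]^d\to\mathbb R$ with distance parameter $\varepsilon\in(0,1/4)$ must make $$\Omega\left(\frac{d\log n}{\varepsilon}-\frac{\log(1/\varepsilon)}{\varepsilon}\right)$$ queries. That is, there is an absolute constant $c>0$ such that for all integers $n,d\ge 1$, all $\varepsilon\in(0,1/4)$ and all integers $q\ge 0$, if some unateness tester for functions $f:[n]^d\to\mathbb R$ with distance parameter $\varepsilon$ makes at most $q$ queries on every input and for every outcome of its randomness, then $$q\ \ge\ c\left(\frac{d\log n}{\varepsilon}-\frac{\log(1/\varepsilon)}{\varepsilon}\right).$$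 -/

import Mathlib

open MeasureTheory

/-- Points of the hypergrid `[n]^d`. -/
abbrev Hypergrid (n d : ℕ) : Type := Fin d → Fin n

/-- `f : [n]^d → ℝ` is unate: for every coordinate `i`, either `f` is nondecreasing in coordinate
`i` (along every line in direction `i`), or `f` is nonincreasing in coordinate `i` (along every
such line). -/
def IsUnate {n d : ℕ} (f : Hypergrid n d → ℝ) : Prop :=
  ∀ i : Fin d,
    (∀ x : Hypergrid n d, Monotone fun a : Fin n => f (Function.update x i a)) ∨
    (∀ x : Hypergrid n d, Antitone fun a : Fin n => f (Function.update x i a))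

/-- `f` is `ε`-far from unate: every unate function differs from `f` on at least an `ε` fraction
of the points of the domain. -/
def IsFarFromUnate {n d : ℕ} (ε : ℝ) (f : Hypergrid n d → ℝ) : Prop :=
  ∀ g : Hypergrid n d → ℝ, IsUnate g →
    ε * (Fintype.card (Hypergrid n d) : ℝ) ≤ (hammingDist f g : ℝ)

/-- Deterministic adaptive query algorithms for real-valued functions on `X`: either output a
verdict (`true` for accept, `false` for reject), or query a point and continue in a way that
depends on the answer. -/
inductive QueryAlgorithm (X : Type) : Type
  | output (verdict : Bool) : QueryAlgorithm X
  | query (x : X) (next : ℝ → QueryAlgorithm X) : QueryAlgorithm X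

namespace QueryAlgorithm

/-- The points queried by the algorithm on input `f`, in the order in which they are queried. -/
def queries {X : Type} (f : X → ℝ) : QueryAlgorithm X → List X
  | output _ => []
  | query x next => x :: queries f (next (f x))

/-- The verdict of the algorithm on input `f`. -/
def verdict {X : Type} (f : X → ℝ) : QueryAlgorithm X → Bool
  | output b => b
  | query x next => verdict f (next (f x))

/-- The number of queries that the algorithm makes on input `f`. -/
def numQueries {X : Type} (f : X → ℝ) (T : QueryAlgorithm X) : ℕ := (T.queries f).length

end QueryAlgorithm

/-- A randomized adaptive query algorithm: a deterministic one for each outcome of the internal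
randomness, which is an arbitrary measurable space `Ω` (later equipped with a probability measure).
On each input, the sequence of queried points and the verdict are random variables. -/
structure RandomizedAlgorithm (X : Type) (Ω : Type*) [MeasurableSpace Ω] where
  alg : Ω → QueryAlgorithm X
  measurableSet_run : ∀ (f : X → ℝ) (l : List X) (b : Bool),
    MeasurableSet {ω | (alg ω).queries f = l ∧ (alg ω).verdict f = b}

/-- `A`, with internal randomness distributed according to `μ`, is a (two-sided error) tester for
unateness of functions `f : [n]^d → ℝ` with distance parameter `ε`: it accepts every unate function
with probability at least `2/3` and rejects every function that is `ε`-far from unate with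
probability at least `2/3`. -/
def IsUnatenessTester {n d : ℕ} {Ω : Type*} [MeasurableSpace Ω] (ε : ℝ) (μ : Measure Ω)
    (A : RandomizedAlgorithm (Hypergrid n d) Ω) : Prop :=
  (∀ f : Hypergrid n d → ℝ, IsUnate f → 2 / 3 ≤ μ.real {ω | (A.alg ω).verdict f = true}) ∧
  (∀ f : Hypergrid n d → ℝ, IsFarFromUnate ε f →
    2 / 3 ≤ μ.real {ω | (A.alg ω).verdict f = false})

/-- On every input and for every outcome of the internal randomness, `A` makes at most `q`
queries. -/
def MakesAtMostQueries {X : Type} {Ω : Type*} [MeasurableSpace Ω]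
    (A : RandomizedAlgorithm X Ω) (q : ℕ) :
    Prop :=
  ∀ (f : X → ℝ) (ω : Ω), (A.alg ω).numQueries f ≤ q

/-!
The lower bound is a counting argument for comparisons. Put `N = n ^ d` and let `M` be of order
`ε * N`. Reading the coordinates of a point as base `2 ^ L` digits gives a code `gridCode` for which
every increasing function is unate. Cut the grid into about `N / M` blocks of size about `M`, each
consisting of the points that share the high coordinates, and a dyadic interval in one further
coordinate. For a block `b` and a bit `t` of the code inside the block, reverse the comparison of two
points of `b` whenever `t` is the highest bit in which their codes differ (`flipKey`). A function
increasing along the new order is `ε`-far from unate (`isFarFromUnate_of_flipKey`): bit `t` belongs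
to some direction `i`, in which the block contains `ε * N` disjoint decreasing pairs, while the pairs
at another bit of coordinate `i`, or in another block, are still increasing. There are about
`(1 / ε) * log (ε * N)` choices of `(b, t)` (`card_levels`, `card_le_two_mul_card_isFull`), and
`log (ε * N) = d * log n - log (1 / ε)`.

A set of `q` points can tell at most `q` of these orders from the original one, because the highest
differing bit is an ultrametric and a `q`-point ultrametric space has fewer than `q` nonzero
distances
(`card_isFlipped_le`). So a tester that only compares values needs a number of queries proportional to
the number of pairs `(b, t)`.

A general tester may use the values themselves. Instead of Ramsey's theorem, the reduction to
comparisons uses values that are generic for an iterated ultrafilter (`genericAssignment`): the points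
receive their values one after the other, in increasing order, each along a fixed ultrafilter on `ℝ`
finer than `atTop`. The generic behaviour of the values at a set `S` of points depends only on the
order on `S` (`map_genericAssignment_eq`). A run of the tester depends only on the values at
the queried points, so the limit of its probability along the generic assignment depends only on
the order of these points (`card_le_three_mul_queries`). The limits retain the finite additivity
that the counting argument uses.
-/

/-! ### Generic assignments of values -/

open Filter in
/-- The law of a generic assignment of values to the points of a list: the value of each point is
chosen along a fixed ultrafilter on `ℝ` finer than `atTop`, later points of the list being chosen
after, and hence being generically larger than, the earlier ones. Points outside the list get
the value `0`. -/
noncomputable def genericAssignment {X : Type} [DecidableEq X] : List X → Ultrafilter (X → ℝ)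
  | [] => pure 0
  | x :: xs => (Ultrafilter.of (atTop : Filter ℝ)).bind fun v =>
      (genericAssignment xs).map fun f => Function.update f x v

section Generic

variable {X : Type} [DecidableEq X]

lemma mem_genericAssignment_cons {x : X} {xs : List X} {T : Set (X → ℝ)} :
    T ∈ genericAssignment (x :: xs) ↔
      ∀ᶠ v in (Ultrafilter.of (Filter.atTop : Filter ℝ) : Filter ℝ),
        {f | Function.update f x v ∈ T} ∈ genericAssignment xs :=
  Iff.rfl

lemma eventually_genericAssignment_pairwise {xs : List X} (h : xs.Nodup) (c : ℝ) :
    ∀ᶠ f in (genericAssignment xs : Filter (X → ℝ)),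
      (∀ x ∈ xs, c < f x) ∧ xs.Pairwise (fun x y => f x < f y) := by
  induction xs generalizing c with
  | nil => simp
  | cons x xs ih =>
    rw [List.nodup_cons] at h
    refine mem_genericAssignment_cons.2 ?_
    filter_upwards [Ultrafilter.of_le _ (Filter.eventually_gt_atTop c)] with v hv
    filter_upwards [ih h.2 v] with f hf
    have hne : ∀ y ∈ xs, Function.update f x v y = f y := fun y hy =>
      Function.update_of_ne (fun e : y = x => h.1 (e ▸ hy)) _ _
    refine ⟨?_, ?_⟩
    · intro y hy
      rcases List.mem_cons.1 hy with rfl | hy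
      · simpa using hv
      · rw [hne y hy]; exact lt_trans hv (hf.1 y hy)
    · refine List.pairwise_cons.2 ⟨fun y hy => ?_, ?_⟩
      · rw [hne y hy]; simpa using hf.1 y hy
      · refine hf.2.imp_of_mem fun {a b} ha hb hab => ?_
        rwa [hne a ha, hne b hb]

/-- The generic assignment is consistent under restriction: on events that depend only on the
values at the points of `S`, the points outside `S` can be removed from the list. -/
lemma mem_genericAssignment_filter (S : Finset X) {xs : List X} {T : Set (X → ℝ)}
    (hT : ∀ f g : X → ℝ, (∀ x ∈ S, f x = g x) → f ∈ T → g ∈ T) :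
    T ∈ genericAssignment xs ↔ T ∈ genericAssignment (xs.filter (· ∈ S)) := by
  induction xs generalizing T with
  | nil => rfl
  | cons x xs ih =>
    have key : ∀ v, {f | Function.update f x v ∈ T} ∈ genericAssignment xs ↔
        {f | Function.update f x v ∈ T} ∈ genericAssignment (xs.filter (· ∈ S)) := by
      intro v
      refine ih fun f g hfg hf => hT _ _ (fun y hy => ?_) hf
      by_cases hyx : y = x
      · subst hyx; simp
      · simpa [hyx] using hfg y hy
    by_cases hx : x ∈ S
    · rw [List.filter_cons_of_pos (by simpa using hx), mem_genericAssignment_cons,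
        mem_genericAssignment_cons]
      simp only [key]
    · rw [List.filter_cons_of_neg (by simpa using hx), mem_genericAssignment_cons]
      have hv : ∀ v, {f | Function.update f x v ∈ T} = T := fun v => by
        ext f
        have hag : ∀ y ∈ S, Function.update f x v y = f y := fun y hy =>
          Function.update_of_ne (fun e : y = x => hx (e ▸ hy)) _ _
        exact ⟨hT _ _ hag, hT _ _ fun y hy => (hag y hy).symm⟩
      simp only [hv, Filter.eventually_const]
      exact ih hT

/-- A function of the assignment that depends only on the values at the points of `S` has the same
generic behaviour along two lists that induce the same order on `S`. -/
lemma map_genericAssignment_eq {α : Type*} (S : Finset X) {xs ys : List X}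
    (h : xs.filter (· ∈ S) = ys.filter (· ∈ S)) {F : (X → ℝ) → α}
    (hF : ∀ f g : X → ℝ, (∀ x ∈ S, f x = g x) → F f = F g) :
    (genericAssignment xs).map F = (genericAssignment ys).map F := by
  ext T
  have hT : ∀ f g : X → ℝ, (∀ x ∈ S, f x = g x) → f ∈ F ⁻¹' T → g ∈ F ⁻¹' T := by
    intro f g hfg hf
    simpa [Set.mem_preimage, ← hF f g hfg] using hf
  rw [Ultrafilter.mem_map, Ultrafilter.mem_map, mem_genericAssignment_filter S hT, h,
    ← mem_genericAssignment_filter S hT]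

end Generic

/-! ### Runs of a tester on generic inputs -/

namespace QueryAlgorithm

/-- A run depends only on the values of the input at the queried points. -/
lemma run_eq_of_agree {X : Type} {f g : X → ℝ} (T : QueryAlgorithm X)
    (h : ∀ x ∈ T.queries f, f x = g x) :
    T.queries g = T.queries f ∧ T.verdict g = T.verdict f := by
  induction T with
  | output b => exact ⟨rfl, rfl⟩
  | query x next ih =>
    have hx : f x = g x := h x (by simp [queries])
    have := ih (f x) fun y hy => h y (by simp [queries, hy])
    simp only [queries, verdict, ← hx]
    exact ⟨by rw [this.1], this.2⟩

end QueryAlgorithm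

section Runs

variable {X : Type} {Ω : Type*} [MeasurableSpace Ω]

/-- The event that the run of `A` on the input `f` queries exactly the list `l` and ends with the
verdict `b`. -/
def runEvent (A : RandomizedAlgorithm X Ω) (f : X → ℝ) (l : List X) (b : Bool) : Set Ω :=
  {ω | (A.alg ω).queries f = l ∧ (A.alg ω).verdict f = b}

lemma runEvent_congr (A : RandomizedAlgorithm X Ω) {f g : X → ℝ} {l : List X}
    (h : ∀ x ∈ l, f x = g x) (b : Bool) : runEvent A f l b = runEvent A g l b := by
  ext ω
  constructor
  · rintro ⟨rfl, rfl⟩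
    exact (A.alg ω).run_eq_of_agree h
  · rintro ⟨rfl, rfl⟩
    exact (A.alg ω).run_eq_of_agree fun x hx => (h x hx).symm

variable [Fintype X] {A : RandomizedAlgorithm X Ω} {q : ℕ}

lemma measureReal_verdict_eq_sum (μ : Measure Ω) [IsProbabilityMeasure μ]
    (hq : MakesAtMostQueries A q) (f : X → ℝ) (b : Bool) :
    μ.real {ω | (A.alg ω).verdict f = b} =
      ∑ l ∈ (List.finite_length_le X q).toFinset, μ.real (runEvent A f l b) := by
  rw [← measureReal_biUnion_finset]
  · congr 1
    ext ω
    have := hq f ω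
    simp only [QueryAlgorithm.numQueries] at this
    simp [runEvent, this]
  · intro l _ l' _ hne
    refine Set.disjoint_left.2 fun ω h h' => hne ?_
    exact h.1.symm.trans h'.1
  · intro l _
    exact A.measurableSet_run f l b

/-- **Adaptive queries only see comparisons.** Suppose that the algorithm accepts generic inputs
increasing along `xs`, and rejects, for each `j ∈ J`, generic inputs increasing along `ys j`. If every
set of `q` points is ordered differently by `xs` and by `ys j` for at most `q` indices `j`, then there
are at most `3 * q` indices.

For a possible query list `l` and verdict `b`, the limit `p xs l b` of the probability of this run along
the generic assignment depends only on the order that `xs` induces on `l`. As the rejection limits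
along `ys j` leave at most `1 / 3` for acceptance, with `p xs`-weight at least `1 / 3` an
accepting run distinguishes `xs` from `ys j`; summing over `j` gives the bound. -/
theorem card_le_three_mul_queries [DecidableEq X] (μ : Measure Ω) [IsProbabilityMeasure μ]
    (hq : MakesAtMostQueries A q) (xs : List X) {ι : Type*} (J : Finset ι) (ys : ι → List X)
    (hacc : ∀ᶠ f in (genericAssignment xs : Filter (X → ℝ)),
      2 / 3 ≤ μ.real {ω | (A.alg ω).verdict f = true})
    (hrej : ∀ j ∈ J, ∀ᶠ f in (genericAssignment (ys j) : Filter (X → ℝ)),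
      2 / 3 ≤ μ.real {ω | (A.alg ω).verdict f = false})
    (hS : ∀ S : Finset X, S.card ≤ q →
      (J.filter fun j => xs.filter (· ∈ S) ≠ (ys j).filter (· ∈ S)).card ≤ q) :
    (J.card : ℝ) ≤ 3 * q := by
  classical
  set R : Finset (List X) := (List.finite_length_le X q).toFinset with hR
  have hlim : ∀ (zs l : List X), ∃ p : ℝ, 0 ≤ p ∧
      Filter.Tendsto (fun f => μ.real (runEvent A f l true)) (genericAssignment zs) (nhds p) := by
    intro zs l
    have hle : ((genericAssignment zs).map fun f => μ.real (runEvent A f l true) : Filter ℝ) ≤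
        Filter.principal (Set.Icc 0 1) :=
      Filter.tendsto_principal.2 (Filter.Eventually.of_forall fun f =>
        ⟨measureReal_nonneg, measureReal_le_one⟩)
    obtain ⟨p, hp, hle⟩ := isCompact_Icc.ultrafilter_le_nhds _ hle
    exact ⟨p, hp.1, hle⟩
  choose p hp0 hp using hlim
  have hsum : ∀ zs, Filter.Tendsto (fun f => μ.real {ω | (A.alg ω).verdict f = true})
      (genericAssignment zs) (nhds (∑ l ∈ R, p zs l)) := by
    intro zs
    simp only [measureReal_verdict_eq_sum μ hq _ true]
    exact tendsto_finsetSum _ fun l _ => hp zs l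
  have hxs : 2 / 3 ≤ ∑ l ∈ R, p xs l := ge_of_tendsto (hsum xs) hacc
  have hxs1 : ∑ l ∈ R, p xs l ≤ 1 :=
    le_of_tendsto (hsum xs) (Filter.Eventually.of_forall fun f => measureReal_le_one)
  have hys : ∀ j ∈ J, ∑ l ∈ R, p (ys j) l ≤ 1 / 3 := by
    intro j hj
    refine le_of_tendsto (hsum _) ?_
    filter_upwards [hrej j hj] with f hf
    have hdisj : Disjoint {ω | (A.alg ω).verdict f = true} {ω | (A.alg ω).verdict f = false} :=
      Set.disjoint_left.2 fun ω (h : _ = _) (h' : _ = _) => by simp [h] at h'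
    have hmeas : MeasurableSet {ω | (A.alg ω).verdict f = false} := by
      have : {ω | (A.alg ω).verdict f = false} = ⋃ l : R, runEvent A f l false := by
        ext ω
        have := hq f ω
        simp only [QueryAlgorithm.numQueries] at this
        simp [runEvent, hR, this]
      rw [this]
      exact MeasurableSet.iUnion fun l => A.measurableSet_run f l false
    have := measureReal_union (μ := μ) hdisj hmeas
    have h1 : μ.real ({ω | (A.alg ω).verdict f = true} ∪ {ω | (A.alg ω).verdict f = false}) ≤ 1 :=
      measureReal_le_one
    linarith
  have heq : ∀ j l, xs.filter (· ∈ l.toFinset) = (ys j).filter (· ∈ l.toFinset) →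
      p xs l = p (ys j) l := by
    intro j l h
    have hmap := map_genericAssignment_eq (F := fun f => μ.real (runEvent A f l true)) l.toFinset h
      fun f g hfg => by rw [runEvent_congr A fun x hx => hfg x (List.mem_toFinset.2 hx)]
    refine tendsto_nhds_unique (hp xs l) ?_
    have h2 := hp (ys j) l
    have hmap' : Filter.map (fun f => μ.real (runEvent A f l true)) (genericAssignment xs) =
      Filter.map (fun f => μ.real (runEvent A f l true)) (genericAssignment (ys j)) :=
      congrArg Ultrafilter.toFilter hmap
    exact hmap'.le.trans h2
  have hbad : ∀ j ∈ J, (1 / 3 : ℝ) ≤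
      ∑ l ∈ R with xs.filter (· ∈ l.toFinset) ≠ (ys j).filter (· ∈ l.toFinset), p xs l := by
    intro j hj
    have hsplit := Finset.sum_filter_add_sum_filter_not R
      (fun l => xs.filter (· ∈ l.toFinset) = (ys j).filter (· ∈ l.toFinset)) (p xs)
    have hgood : ∑ l ∈ R with xs.filter (· ∈ l.toFinset) = (ys j).filter (· ∈ l.toFinset),
        p xs l ≤ 1 / 3 := by
      refine le_trans ?_ (hys j hj)
      rw [Finset.sum_congr rfl fun l hl => heq j l (Finset.mem_filter.1 hl).2]
      exact Finset.sum_le_sum_of_subset_of_nonneg (Finset.filter_subset _ _) fun l _ _ => hp0 _ _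
    simp only [ne_eq] at hsplit ⊢
    linarith
  have h1 : (J.card : ℝ) * (1 / 3) ≤ ∑ j ∈ J,
      ∑ l ∈ R with xs.filter (· ∈ l.toFinset) ≠ (ys j).filter (· ∈ l.toFinset), p xs l := by
    rw [← nsmul_eq_mul]
    exact Finset.card_nsmul_le_sum _ _ _ hbad
  have h2 : ∑ j ∈ J,
      ∑ l ∈ R with xs.filter (· ∈ l.toFinset) ≠ (ys j).filter (· ∈ l.toFinset), p xs l ≤
      ∑ l ∈ R, q * p xs l := by
    simp only [Finset.sum_filter]
    rw [Finset.sum_comm]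
    refine Finset.sum_le_sum fun l hl => ?_
    rw [← Finset.sum_filter, Finset.sum_const, nsmul_eq_mul]
    refine mul_le_mul_of_nonneg_right ?_ (hp0 _ _)
    have hl' : l.length ≤ q := by simpa [hR] using hl
    exact_mod_cast hS l.toFinset ((List.toFinset_card_le l).trans hl')
  rw [← Finset.mul_sum] at h2
  have h3 : (q : ℝ) * ∑ l ∈ R, p xs l ≤ q := mul_le_of_le_one_right (Nat.cast_nonneg q) hxs1
  linarith

end Runs

/-! ### Sorting by a key -/

section KeySort

variable {X : Type} [Fintype X] {K K' : Type*} [LinearOrder K] [LinearOrder K']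

/-- The list of all points, sorted by increasing key. -/
noncomputable def keySort (κ : X → K) : List X :=
  Finset.univ.toList.mergeSort fun x y => decide (κ x ≤ κ y)

lemma nodup_keySort (κ : X → K) : (keySort κ).Nodup :=
  (List.mergeSort_perm _ _).nodup_iff.2 (Finset.nodup_toList _)

lemma mem_keySort (κ : X → K) (x : X) : x ∈ keySort κ := by
  simp [keySort]

lemma pairwise_keySort {κ : X → K} (hκ : Function.Injective κ) :
    (keySort κ).Pairwise fun x y => κ x < κ y := by
  have h : (keySort κ).Pairwise fun x y => decide (κ x ≤ κ y) = true :=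
    List.pairwise_mergeSort (fun a b c hab hbc => by simp at *; exact hab.trans hbc)
      (fun a b => by simpa using le_total (κ a) (κ b)) _
  refine (h.and (nodup_keySort κ)).imp fun {a b} hab => ?_
  exact lt_of_le_of_ne (by simpa using hab.1) fun e => hab.2 (hκ e)

lemma filter_keySort_eq [DecidableEq X] {κ : X → K} {κ' : X → K'} (hκ : Function.Injective κ)
    (hκ' : Function.Injective κ') {S : Finset X}
    (h : ∀ x ∈ S, ∀ y ∈ S, κ x < κ y → κ' x < κ' y) :
    (keySort κ).filter (· ∈ S) = (keySort κ').filter (· ∈ S) := by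
  refine List.Perm.eq_of_pairwise (le := fun x y => κ' x < κ' y) ?_ ?_ ?_ ?_
  · exact fun a b _ _ hab hba => absurd hab hba.asymm
  · refine ((pairwise_keySort hκ).filter _).imp_of_mem fun {a b} ha hb hab => ?_
    exact h a (by simpa using (List.mem_filter.1 ha).2) b
      (by simpa using (List.mem_filter.1 hb).2) hab
  · exact (pairwise_keySort hκ').filter _
  · refine (List.perm_ext_iff_of_nodup ((nodup_keySort κ).filter _)
      ((nodup_keySort κ').filter _)).2 fun x => ?_
    simp [mem_keySort]

lemma eventually_genericAssignment_keySort [DecidableEq X] {κ : X → K}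
    (hκ : Function.Injective κ) :
    ∀ᶠ f in (genericAssignment (keySort κ) : Filter (X → ℝ)), ∀ x y, κ x < κ y → f x < f y := by
  filter_upwards [eventually_genericAssignment_pairwise (nodup_keySort κ) 0] with f hf x y hxy
  have hpair : (keySort κ).Pairwise fun x y => (κ x < κ y → f x < f y) ∧ (κ y < κ x → f y < f x) :=
    (hf.2.and (pairwise_keySort hκ)).imp fun {a b} hab =>
      ⟨fun _ => hab.1, fun hba => absurd hba hab.2.asymm⟩
  have : Std.Symm fun x y => (κ x < κ y → f x < f y) ∧ (κ y < κ x → f y < f x) :=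
    ⟨fun _ _ hab => ⟨hab.2, hab.1⟩⟩
  exact ((hpair.forall_of_forall (fun a _ =>
    ⟨fun ha => absurd ha (lt_irrefl _), fun ha => absurd ha (lt_irrefl _)⟩)
    (mem_keySort κ x) (mem_keySort κ y)).1 hxy)

end KeySort

/-! ### Flipping one level of a binary code -/

section FlipKey

variable {X : Type} {Λ : Type*}

/-- The points `x` and `y` have label `b`, and `t` is the highest bit in which their codes differ. -/
def IsFlipped (E : X → ℕ) (lab : X → Λ) (b : Λ) (t : ℕ) (x y : X) : Prop :=
  E x / 2 ^ (t + 1) = E y / 2 ^ (t + 1) ∧ E x / 2 ^ t ≠ E y / 2 ^ t ∧ lab x = b ∧ lab y = b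

variable [DecidableEq Λ]

/-- The key obtained from an injective code `E : X → ℕ` by reversing the order of two points of
label `b` whenever `t` is the highest bit in which their codes differ. All other comparisons are
those of the codes, provided that points whose codes agree above bit `t` have the same label. -/
def flipKey (E : X → ℕ) (lab : X → Λ) (b : Λ) (t : ℕ) (x : X) : ℕ ×ₗ ℤ ×ₗ ℕ :=
  toLex (E x / 2 ^ (t + 1), toLex (if lab x = b then -((E x / 2 ^ t : ℕ) : ℤ) else 0, E x))

variable {E : X → ℕ} {lab : X → Λ} {b : Λ} {t : ℕ}

lemma injective_flipKey (hE : Function.Injective E) : Function.Injective (flipKey E lab b t) := by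
  intro x y h
  simp only [flipKey, toLex_inj, Prod.mk.injEq] at h
  exact hE h.2.2

lemma flipKey_lt_iff {x y : X} : flipKey E lab b t x < flipKey E lab b t y ↔
    E x / 2 ^ (t + 1) < E y / 2 ^ (t + 1) ∨ E x / 2 ^ (t + 1) = E y / 2 ^ (t + 1) ∧
      ((if lab x = b then -((E x / 2 ^ t : ℕ) : ℤ) else 0) <
          (if lab y = b then -((E y / 2 ^ t : ℕ) : ℤ) else 0) ∨
        (if lab x = b then -((E x / 2 ^ t : ℕ) : ℤ) else 0) =
          (if lab y = b then -((E y / 2 ^ t : ℕ) : ℤ) else 0) ∧ E x < E y) := by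
  simp only [flipKey, Prod.Lex.toLex_lt_toLex]

lemma flipKey_lt_of_lt {x y : X} (hlt : E x < E y)
    (hlab : E x / 2 ^ (t + 1) = E y / 2 ^ (t + 1) → lab x = lab y)
    (h : ¬ IsFlipped E lab b t x y) : flipKey E lab b t x < flipKey E lab b t y := by
  rw [flipKey_lt_iff]
  rcases (Nat.div_le_div_right (c := 2 ^ (t + 1)) hlt.le).lt_or_eq with h1 | h1
  · exact Or.inl h1
  · refine Or.inr ⟨h1, Or.inr ⟨?_, hlt⟩⟩
    have hl := hlab h1
    by_cases hb : lab x = b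
    · have : E x / 2 ^ t = E y / 2 ^ t := by
        by_contra hne
        exact h ⟨h1, hne, hb, hl ▸ hb⟩
      rw [if_pos hb, if_pos (hl ▸ hb), this]
    · rw [if_neg hb, if_neg (hl ▸ hb)]

lemma flipKey_lt_of_isFlipped {x y : X} (hlt : E x < E y) (h : IsFlipped E lab b t x y) :
    flipKey E lab b t y < flipKey E lab b t x := by
  rw [flipKey_lt_iff]
  obtain ⟨h1, h2, hx, hy⟩ := h
  refine Or.inr ⟨h1.symm, Or.inl ?_⟩
  have : E x / 2 ^ t < E y / 2 ^ t := lt_of_le_of_ne (Nat.div_le_div_right hlt.le) h2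
  rw [if_pos hx, if_pos hy]
  omega

open Classical in
/-- A set `S` of points separates at most `|S|` pairs of a label and a level. Indeed the position of
the highest differing bit is an ultrametric, and a new point `z` contributes at most one new pair:
the label of `z` together with the distance from `z` to its nearest neighbour in `S`. -/
lemma card_isFlipped_le (𝓑 : Finset Λ) (𝓣 : Finset ℕ)
    (hlab : ∀ t ∈ 𝓣, ∀ x y, E x / 2 ^ (t + 1) = E y / 2 ^ (t + 1) → lab x = lab y) (S : Finset X) :
    ((𝓑 ×ˢ 𝓣).filter fun p => ∃ x ∈ S, ∃ y ∈ S, IsFlipped E lab p.1 p.2 x y).card ≤ S.card := by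
  have hsymm : ∀ {b : Λ} {t : ℕ} {x y : X}, IsFlipped E lab b t x y → IsFlipped E lab b t y x :=
    fun h => ⟨h.1.symm, h.2.1.symm, h.2.2.2, h.2.2.1⟩
  induction S using Finset.induction_on with
  | empty => simp
  | insert z S hz ih =>
    rcases S.eq_empty_or_nonempty with rfl | ⟨y₀, hy₀⟩
    · refine (Finset.card_eq_zero.2 (Finset.filter_eq_empty_iff.2 ?_)).trans_le (Nat.zero_le _)
      rintro p - ⟨x, hx, y, hy, h⟩
      simp only [insert_empty_eq, Finset.mem_singleton] at hx hy
      subst hx; subst hy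
      exact h.2.1 rfl
    · have hex : ∃ t, ∃ y ∈ S, E y / 2 ^ t = E z / 2 ^ t := by
        refine ⟨E y₀ + E z, y₀, hy₀, ?_⟩
        have h2 := (Nat.lt_two_pow_self (n := E y₀ + E z))
        rw [Nat.div_eq_of_lt (by omega), Nat.div_eq_of_lt (by omega)]
      obtain ⟨y₁, hy₁, he⟩ := Nat.find_spec hex
      set t₀ := Nat.find hex with ht₀
      have hnew : ∀ b, ∀ t ∈ 𝓣, ∀ y ∈ S, IsFlipped E lab b t z y →
          (b, t) = (lab z, t₀ - 1) ∨ ∃ x ∈ S, ∃ y ∈ S, IsFlipped E lab b t x y := by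
        intro b t ht y hy h
        have hle : t₀ ≤ t + 1 := Nat.find_min' hex ⟨y, hy, h.1.symm⟩
        rcases hle.eq_or_lt with heq | hlt
        · left; rw [h.2.2.1, heq]; rfl
        · right
          have hpow : ∀ {m}, t₀ ≤ m → E y₁ / 2 ^ m = E z / 2 ^ m := by
            intro m hm
            obtain ⟨r, rfl⟩ := Nat.exists_eq_add_of_le hm
            rw [pow_add, ← Nat.div_div_eq_div_mul, ← Nat.div_div_eq_div_mul, he]
          refine ⟨y₁, hy₁, y, hy, (hpow hle).trans h.1, ?_, ?_, h.2.2.2⟩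
          · rw [hpow (Nat.lt_succ_iff.1 hlt)]; exact h.2.1
          · rw [hlab t ht _ _ (hpow hle)]; exact h.2.2.1
      have hsub : ((𝓑 ×ˢ 𝓣).filter fun p =>
          ∃ x ∈ insert z S, ∃ y ∈ insert z S, IsFlipped E lab p.1 p.2 x y) ⊆
          insert (lab z, t₀ - 1)
            ((𝓑 ×ˢ 𝓣).filter fun p => ∃ x ∈ S, ∃ y ∈ S, IsFlipped E lab p.1 p.2 x y) := by
        rintro ⟨b, t⟩ hp
        obtain ⟨hp, x, hx, y, hy, h⟩ := Finset.mem_filter.1 hp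
        have ht := (Finset.mem_product.1 hp).2
        have : (b, t) = (lab z, t₀ - 1) ∨ ∃ x ∈ S, ∃ y ∈ S, IsFlipped E lab b t x y := by
          rcases Finset.mem_insert.1 hx with rfl | hx' <;>
            rcases Finset.mem_insert.1 hy with rfl | hy'
          · exact absurd rfl h.2.1
          · exact hnew b t ht y hy' h
          · exact hnew b t ht x hx' (hsymm h)
          · exact Or.inr ⟨x, hx', y, hy', h⟩
        rw [Finset.mem_insert, Finset.mem_filter]
        exact this.imp_right fun h => ⟨hp, h⟩
      rw [Finset.card_insert_of_notMem hz]
      exact (Finset.card_le_card hsub).trans ((Finset.card_insert_le _ _).trans (by omega))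

/-- A tester that accepts all functions increasing along the code `E`, and rejects all functions
increasing along one of the keys `flipKey E lab b t`, makes at least a third as many queries as
there are pairs `(b, t)`. -/
theorem card_mul_card_le_three_mul_queries [Fintype X] {Ω : Type*} [MeasurableSpace Ω]
    {A : RandomizedAlgorithm X Ω} {q : ℕ} (μ : Measure Ω) [IsProbabilityMeasure μ]
    (hq : MakesAtMostQueries A q) (hE : Function.Injective E) (𝓑 : Finset Λ) (𝓣 : Finset ℕ)
    (hlab : ∀ t ∈ 𝓣, ∀ x y, E x / 2 ^ (t + 1) = E y / 2 ^ (t + 1) → lab x = lab y)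
    (hacc : ∀ f : X → ℝ, (∀ x y, E x < E y → f x < f y) →
      2 / 3 ≤ μ.real {ω | (A.alg ω).verdict f = true})
    (hrej : ∀ b ∈ 𝓑, ∀ t ∈ 𝓣, ∀ f : X → ℝ,
      (∀ x y, flipKey E lab b t x < flipKey E lab b t y → f x < f y) →
      2 / 3 ≤ μ.real {ω | (A.alg ω).verdict f = false}) :
    (𝓑.card : ℝ) * 𝓣.card ≤ 3 * q := by
  classical
  have := card_le_three_mul_queries μ hq (keySort E) (𝓑 ×ˢ 𝓣)
    (fun p => keySort (flipKey E lab p.1 p.2)) ?_ ?_ ?_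
  · simpa using this
  · filter_upwards [eventually_genericAssignment_keySort hE] with f hf using hacc f hf
  · intro p hp
    rw [Finset.mem_product] at hp
    filter_upwards [eventually_genericAssignment_keySort
      (injective_flipKey (lab := lab) (b := p.1) (t := p.2) hE)] with f hf
    exact hrej _ hp.1 _ hp.2 f hf
  · intro S hS
    refine le_trans (Finset.card_le_card ?_) ((card_isFlipped_le 𝓑 𝓣 hlab S).trans hS)
    intro p hp
    rw [Finset.mem_filter] at hp ⊢
    refine ⟨hp.1, ?_⟩
    by_contra hno
    refine hp.2 (filter_keySort_eq hE (injective_flipKey hE) fun x hx y hy hxy => ?_)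
    exact flipKey_lt_of_lt hxy (hlab _ (Finset.mem_product.1 hp.1).2 x y)
      fun h => hno ⟨x, hx, y, hy, h⟩

end FlipKey

/-! ### A binary code for the hypergrid -/

section Code

variable {n d L : ℕ}

/-- The points of the hypergrid, read as numbers in base `2 ^ L` whose digits are the coordinates,
the first coordinate being the least significant digit. -/
def gridCode (L : ℕ) (x : Hypergrid n d) : ℕ := ∑ i, (x i : ℕ) * (2 ^ L) ^ (i : ℕ)

lemma gridCode_digit (hL : n ≤ 2 ^ L) (x : Hypergrid n d) (i : Fin d) :
    gridCode L x / 2 ^ (L * i) % 2 ^ L = x i := by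
  have h := congrFun (finFunctionFinEquiv.symm_apply_apply fun j => Fin.castLE hL (x j)) i
  have h' := congrArg Fin.val h
  rw [pow_mul]
  exact h'

lemma gridCode_injective (hL : n ≤ 2 ^ L) :
    Function.Injective (gridCode L : Hypergrid n d → ℕ) := by
  intro x y h
  ext i
  rw [← gridCode_digit hL x i, h, gridCode_digit hL y i]

lemma gridCode_update_le (x : Hypergrid n d) (i : Fin d) {u v : Fin n} (h : u ≤ v) :
    gridCode L (Function.update x i u) ≤ gridCode L (Function.update x i v) := by
  refine Finset.sum_le_sum fun j _ => Nat.mul_le_mul_right _ ?_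
  by_cases hj : j = i
  · subst hj; simpa using h
  · simp [hj]

lemma div_two_pow_eq_of_le {x y s t : ℕ} (h : x / 2 ^ s = y / 2 ^ s) (hst : s ≤ t) :
    x / 2 ^ t = y / 2 ^ t := by
  obtain ⟨r, rfl⟩ := Nat.exists_eq_add_of_le hst
  rw [pow_add, ← Nat.div_div_eq_div_mul, ← Nat.div_div_eq_div_mul, h]

/-- A function increasing along the code is monotone in every coordinate. -/
lemma isUnate_of_gridCode (hL : n ≤ 2 ^ L) {f : Hypergrid n d → ℝ}
    (hf : ∀ x y, gridCode L x < gridCode L y → f x < f y) : IsUnate f := by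
  refine fun i => Or.inl fun x u v huv => ?_
  rcases (gridCode_update_le (L := L) x i huv).lt_or_eq with h | h
  · exact (hf _ _ h).le
  · exact (congrArg f (gridCode_injective hL h)).le

/-- The point obtained by adding `m` to coordinate `i`, if this stays in the hypergrid (and the
same point otherwise). -/
def shiftUp (i : Fin d) (m : ℕ) (x : Hypergrid n d) : Hypergrid n d :=
  if h : x i + m < n then Function.update x i ⟨x i + m, h⟩ else x

lemma gridCode_shiftUp {i : Fin d} {m : ℕ} {x : Hypergrid n d} (h : x i + m < n) :
    gridCode L (shiftUp i m x) = gridCode L x + m * (2 ^ L) ^ (i : ℕ) := by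
  rw [gridCode, gridCode, shiftUp, dif_pos h, ← Finset.add_sum_erase _ _ (Finset.mem_univ i),
    ← Finset.add_sum_erase _ (fun j => (x j : ℕ) * _) (Finset.mem_univ i),
    Finset.sum_congr rfl fun j hj => by rw [Function.update_of_ne (Finset.ne_of_mem_erase hj)]]
  simp
  ring

/-- If bit `k` of coordinate `i` is zero, then raising it changes exactly bit `L * i + k` of the
code. -/
lemma gridCode_shiftUp_bit (hL : n ≤ 2 ^ L) {i : Fin d} {k : ℕ} (hk : k < L) {x : Hypergrid n d}
    (h : x i + 2 ^ k < n) (he : Even (x i / 2 ^ k : ℕ)) :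
    gridCode L x / 2 ^ (L * i + k + 1) = gridCode L (shiftUp i (2 ^ k) x) / 2 ^ (L * i + k + 1) ∧
    gridCode L x / 2 ^ (L * i + k) ≠ gridCode L (shiftUp i (2 ^ k) x) / 2 ^ (L * i + k) := by
  have hE : gridCode L (shiftUp i (2 ^ k) x) = gridCode L x + 2 ^ (L * i + k) := by
    rw [gridCode_shiftUp h, ← pow_mul, ← pow_add, add_comm k]
  have hdiv : gridCode L (shiftUp i (2 ^ k) x) / 2 ^ (L * i + k) =
      gridCode L x / 2 ^ (L * i + k) + 1 := by
    rw [hE, Nat.add_div_right _ (by positivity)]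
  have hpar : gridCode L x / 2 ^ (L * i + k) % 2 = 0 := by
    have hz : ∀ z : ℕ, z % 2 ^ L / 2 ^ k % 2 = z / 2 ^ k % 2 := fun z => by
      rw [← Nat.mod_mul_right_div_self, ← Nat.mod_mul_right_div_self, ← pow_succ,
        Nat.mod_mod_of_dvd _ (pow_dvd_pow 2 hk)]
    rw [← Nat.even_iff.1 he, ← gridCode_digit hL x i, pow_add, ← Nat.div_div_eq_div_mul, hz]
  refine ⟨?_, by omega⟩
  rw [pow_succ, ← Nat.div_div_eq_div_mul, ← Nat.div_div_eq_div_mul, hdiv]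
  omega

end Code

/-! ### Disjoint violating pairs and the distance to unateness -/

section Distance

variable {n d : ℕ}

/-- `u` lies in an even-numbered block of length `m`, and its translate `u + m`, in the next block,
is still in `[n]`. The pairs `{u, u + m}` with this property are disjoint. -/
def IsLower (m : ℕ) (u : Fin n) : Prop := Even (u / m : ℕ) ∧ u + m < n

instance (m : ℕ) (u : Fin n) : Decidable (IsLower m u) :=
  inferInstanceAs (Decidable (_ ∧ _))

lemma shiftUp_apply_self {i : Fin d} {m : ℕ} {x : Hypergrid n d} (h : IsLower m (x i)) :
    (shiftUp i m x i : ℕ) = x i + m := by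
  simp [shiftUp, h.2]

lemma shiftUp_injOn (i : Fin d) (m : ℕ) :
    Set.InjOn (shiftUp i m) {x : Hypergrid n d | IsLower m (x i)} := by
  intro x hx y hy hxy
  ext j
  by_cases hj : j = i
  · subst hj
    have := congrArg (fun z : Hypergrid n d => (z j : ℕ)) hxy
    simp only [shiftUp_apply_self hx, shiftUp_apply_self hy] at this
    omega
  · have hxj := congrArg (fun z : Hypergrid n d => (z j : ℕ)) hxy
    simpa [shiftUp, hx.2, hy.2, hj] using hxj

lemma card_le_hammingDist {i : Fin d} {m : ℕ} (hm : 0 < m) {f g : Hypergrid n d → ℝ}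
    {P : Finset (Hypergrid n d)} (hP : ∀ x ∈ P, IsLower m (x i))
    (h : ∀ x ∈ P, f x ≠ g x ∨ f (shiftUp i m x) ≠ g (shiftUp i m x)) :
    P.card ≤ hammingDist f g := by
  classical
  have hne : ∀ x ∈ P, ∀ y ∈ P, x ≠ shiftUp i m y := by
    intro x hx y hy hxy
    have h1 := shiftUp_apply_self (hP y hy)
    rw [← hxy] at h1
    have h2 := (hP x hx).1
    rw [h1, Nat.add_div_right _ hm, Nat.even_add_one] at h2
    exact h2 (hP y hy).1
  refine Finset.card_le_card_of_injOn (fun x => if f x ≠ g x then x else shiftUp i m x) ?_ ?_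
  · intro x hx
    by_cases hfx : f x ≠ g x
    · simp [hfx]
    · have := (h x hx).resolve_left hfx
      simpa [hfx] using this
  · intro x hx y hy hxy
    dsimp only at hxy
    split_ifs at hxy with h1 h2 h2
    · exact hxy
    · exact absurd hxy (hne x hx y hy)
    · exact absurd hxy.symm (hne y hy x hx)
    · exact shiftUp_injOn i m (hP x hx) (hP y hy) hxy

/-- A function with many disjoint decreasing pairs and many disjoint increasing pairs in the same
direction is far from unate. -/
lemma isFarFromUnate_of_pairs {ε : ℝ} {f : Hypergrid n d → ℝ} {i : Fin d} {m m' : ℕ} (hm : 0 < m)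
    (hm' : 0 < m') {P P' : Finset (Hypergrid n d)} (hP : ∀ x ∈ P, IsLower m (x i))
    (hP' : ∀ x ∈ P', IsLower m' (x i)) (hdec : ∀ x ∈ P, f (shiftUp i m x) < f x)
    (hinc : ∀ x ∈ P', f x < f (shiftUp i m' x))
    (hcard : ε * Fintype.card (Hypergrid n d) ≤ P.card)
    (hcard' : ε * Fintype.card (Hypergrid n d) ≤ P'.card) : IsFarFromUnate ε f := by
  intro g hg
  rcases hg i with hmono | hanti
  · refine hcard.trans (Nat.cast_le.2 (card_le_hammingDist hm hP fun x hx => ?_))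
    by_contra! hfg
    have := hmono x (a := x i) (b := ⟨x i + m, (hP x hx).2⟩) (Fin.le_def.2 (by simp))
    have hs : Function.update x i ⟨x i + m, (hP x hx).2⟩ = shiftUp i m x := by
      rw [shiftUp, dif_pos (hP x hx).2]
    simp only [Function.update_eq_self, hs] at this
    linarith [hdec x hx]
  · refine hcard'.trans (Nat.cast_le.2 (card_le_hammingDist hm' hP' fun x hx => ?_))
    by_contra! hfg
    have := hanti x (a := x i) (b := ⟨x i + m', (hP' x hx).2⟩) (Fin.le_def.2 (by simp))
    have hs : Function.update x i ⟨x i + m', (hP' x hx).2⟩ = shiftUp i m' x := by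
      rw [shiftUp, dif_pos (hP' x hx).2]
    simp only [Function.update_eq_self, hs] at this
    linarith [hinc x hx]

end Distance

/-! ### Counting lower endpoints -/

section Counting

variable {n d : ℕ}

lemma card_piFinset_le_mul_filter (T : Fin d → Finset (Fin n)) (i : Fin d) (p : Fin n → Prop)
    [DecidablePred p] {c : ℕ} (h : (T i).card ≤ c * ((T i).filter p).card) :
    (Fintype.piFinset T).card ≤ c * ((Fintype.piFinset T).filter fun x => p (x i)).card := by
  have hpi : (Fintype.piFinset T).filter (fun x => p (x i)) =
      Fintype.piFinset (Function.update T i ((T i).filter p)) := by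
    ext x
    simp only [Finset.mem_filter, Fintype.mem_piFinset]
    constructor
    · rintro ⟨hx, hp⟩ j
      by_cases hj : j = i
      · subst hj; simpa using ⟨hx j, hp⟩
      · simpa [hj] using hx j
    · intro hx
      have hi := hx i
      rw [Function.update_self, Finset.mem_filter] at hi
      refine ⟨fun j => ?_, hi.2⟩
      by_cases hj : j = i
      · subst hj; exact hi.1
      · simpa [hj] using hx j
  rw [hpi, Fintype.card_piFinset, Fintype.card_piFinset,
    ← Finset.mul_prod_erase _ _ (Finset.mem_univ i),
    ← Finset.mul_prod_erase _ (fun j => (Function.update T i _ j).card) (Finset.mem_univ i),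
    Function.update_self, ← mul_assoc,
    Finset.prod_congr rfl fun j hj => by
      rw [← Function.update_of_ne (Finset.ne_of_mem_erase hj) ((T i).filter p) T]]
  exact Nat.mul_le_mul_right _ h

/-- If `T` contains with each element in an odd block of length `m` its translate in the preceding
block, then at least half of its elements are lower endpoints, up to those whose partner is
missing. -/
lemma card_le_two_mul_isLower_add {m : ℕ} (hm : 0 < m) (T : Finset (Fin n))
    (hT : ∀ u ∈ T, ¬ Even (u / m : ℕ) → ∀ v : Fin n, (v + m : ℕ) = u → v ∈ T) :
    T.card ≤ 2 * (T.filter (IsLower m)).card +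
      (T.filter fun u : Fin n => Even (u / m : ℕ) ∧ n ≤ u + m).card := by
  have hodd : (T.filter fun u : Fin n => ¬ Even (u / m : ℕ)).card ≤ (T.filter (IsLower m)).card := by
    refine Finset.card_le_card_of_injOn
      (fun u : Fin n => ⟨u - m, lt_of_le_of_lt (Nat.sub_le _ _) u.2⟩) ?_ ?_
    · intro u hu
      obtain ⟨huT, hu⟩ := Finset.mem_filter.1 hu
      have hmu : m ≤ (u : ℕ) := by
        by_contra hlt
        rw [Nat.div_eq_of_lt (by omega)] at hu
        simp at hu
      have hadd : (u - m + m : ℕ) = u := Nat.sub_add_cancel hmu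
      rw [Finset.mem_coe, Finset.mem_filter]
      refine ⟨hT u huT hu _ hadd, ?_, by simp [hadd]⟩
      rw [← hadd, Nat.add_div_right _ hm, Nat.even_add_one, not_not] at hu
      exact hu
    · intro u hu v hv huv
      have hge : ∀ w ∈ T.filter fun u : Fin n => ¬ Even (u / m : ℕ), m ≤ (w : ℕ) := by
        intro w hw
        by_contra hlt
        have hw := (Finset.mem_filter.1 hw).2
        rw [Nat.div_eq_of_lt (by omega)] at hw
        simp at hw
      have := hge u hu
      have := hge v hv
      simp only [Fin.mk.injEq] at huv
      exact Fin.ext (by omega)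
  have heven : (T.filter fun u : Fin n => Even (u / m : ℕ)).card =
      (T.filter (IsLower m)).card + (T.filter fun u : Fin n => Even (u / m : ℕ) ∧ n ≤ u + m).card := by
    rw [← Finset.card_filter_add_card_filter_not (s := T.filter fun u : Fin n => Even (u / m : ℕ))
      (fun u : Fin n => (u + m : ℕ) < n), Finset.filter_filter, Finset.filter_filter]
    simp only [not_lt]
    rfl
  have := Finset.card_filter_add_card_filter_not (s := T) (fun u : Fin n => Even (u / m : ℕ))
  omega

lemma le_two_mul_card_isLower_add {m : ℕ} (hm : 0 < m) :
    n ≤ 2 * ((Finset.univ : Finset (Fin n)).filter (IsLower m)).card + m := by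
  have h := card_le_two_mul_isLower_add hm (Finset.univ : Finset (Fin n)) (by simp)
  have h2 : ((Finset.univ : Finset (Fin n)).filter
      fun u : Fin n => Even (u / m : ℕ) ∧ n ≤ u + m).card ≤ m := by
    calc _ ≤ (Finset.Ico (n - m) n).card := by
          refine Finset.card_le_card_of_injOn (fun u : Fin n => (u : ℕ)) ?_ Fin.val_injective.injOn
          intro u hu
          have hu := (Finset.mem_filter.1 hu).2.2
          have := u.2
          simp only [Finset.coe_Ico, Set.mem_Ico]
          omega
      _ ≤ m := by simp; omega
  simp only [Finset.card_univ, Fintype.card_fin] at h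
  omega

lemma card_block_le_two_mul_isLower {k K β : ℕ} (hk : k < K) (hβ : (β + 1) * 2 ^ K ≤ n) :
    ((Finset.univ : Finset (Fin n)).filter fun u : Fin n => (u / 2 ^ K : ℕ) = β).card ≤
      2 * (((Finset.univ : Finset (Fin n)).filter fun u : Fin n => (u / 2 ^ K : ℕ) = β).filter
        (IsLower (2 ^ k))).card := by
  -- Moving between an even block of length `2 ^ k` and the next one preserves blocks of length `2 ^ K`.
  have hstep : ∀ v : ℕ, Even (v / 2 ^ k) → (v + 2 ^ k) / 2 ^ K = v / 2 ^ K := by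
    intro v hv
    obtain ⟨r, rfl⟩ := Nat.exists_eq_add_of_lt hk
    rw [add_assoc, add_comm r, pow_add, ← Nat.div_div_eq_div_mul, ← Nat.div_div_eq_div_mul,
      Nat.add_div_right _ (by positivity), pow_add, pow_one, ← Nat.div_div_eq_div_mul,
      ← Nat.div_div_eq_div_mul]
    congr 1
    rw [Nat.even_iff] at hv
    omega
  have h := card_le_two_mul_isLower_add (m := 2 ^ k) (by positivity)
    ((Finset.univ : Finset (Fin n)).filter fun u : Fin n => (u / 2 ^ K : ℕ) = β) ?_
  · have hempty : ((Finset.univ : Finset (Fin n)).filter fun u : Fin n => (u / 2 ^ K : ℕ) = β).filter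
        (fun u : Fin n => Even (u / 2 ^ k : ℕ) ∧ n ≤ u + 2 ^ k) = ∅ := by
      refine Finset.filter_eq_empty_iff.2 fun u hu => ?_
      rintro ⟨he, hle⟩
      have hu := (Finset.mem_filter.1 hu).2
      have h1 : (u + 2 ^ k : ℕ) / 2 ^ K < β + 1 := by rw [hstep u he, hu]; omega
      rw [Nat.div_lt_iff_lt_mul (by positivity)] at h1
      omega
    rw [hempty] at h
    simpa using h
  · intro u hu hodd v hv
    rw [Finset.mem_filter] at hu ⊢
    refine ⟨Finset.mem_univ _, ?_⟩
    rw [← hv, Nat.add_div_right _ (by positivity), Nat.even_add_one, not_not] at hodd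
    rw [← hstep v hodd, hv, hu.2]

lemma card_block {K β : ℕ} (hβ : (β + 1) * 2 ^ K ≤ n) :
    ((Finset.univ : Finset (Fin n)).filter fun u : Fin n => (u / 2 ^ K : ℕ) = β).card = 2 ^ K := by
  have : ((Finset.univ : Finset (Fin n)).filter fun u : Fin n => (u / 2 ^ K : ℕ) = β).map
      Fin.valEmbedding = Finset.Ico (β * 2 ^ K) ((β + 1) * 2 ^ K) := by
    ext v
    simp only [Finset.mem_map, Finset.mem_filter, Finset.mem_univ, true_and,
      Fin.valEmbedding_apply, Finset.mem_Ico]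
    have hiff : v / 2 ^ K = β ↔ β * 2 ^ K ≤ v ∧ v < (β + 1) * 2 ^ K := by
      rw [Nat.div_eq_iff (by positivity), add_mul, one_mul]
      have : 0 < 2 ^ K := by positivity
      omega
    rw [← hiff]
    constructor
    · rintro ⟨u, hu, rfl⟩; exact hu
    · intro hv
      exact ⟨⟨v, (hiff.1 hv).2.trans_le hβ⟩, hv, rfl⟩
  rw [← Finset.card_map Fin.valEmbedding, this, Nat.card_Ico, add_mul, one_mul,
    Nat.add_sub_cancel_left]

lemma le_two_mul_card_full {K : ℕ} (hK : 2 ^ K ≤ n) :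
    n ≤ 2 * ((Finset.univ : Finset (Fin n)).filter
      fun u : Fin n => (u / 2 ^ K + 1 : ℕ) * 2 ^ K ≤ n).card := by
  have hpos : 0 < 2 ^ K := by positivity
  have hle : n / 2 ^ K * 2 ^ K ≤ n := Nat.div_mul_le_self _ _
  have hsub : (Finset.range (n / 2 ^ K * 2 ^ K)) ⊆ ((Finset.univ : Finset (Fin n)).filter
      fun u : Fin n => (u / 2 ^ K + 1 : ℕ) * 2 ^ K ≤ n).map Fin.valEmbedding := by
    intro v hv
    rw [Finset.mem_range] at hv
    rw [Finset.mem_map]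
    refine ⟨⟨v, hv.trans_le hle⟩, ?_, rfl⟩
    rw [Finset.mem_filter]
    refine ⟨Finset.mem_univ _, le_trans (Nat.mul_le_mul_right _ ?_) hle⟩
    exact Nat.succ_le_of_lt ((Nat.div_lt_iff_lt_mul hpos).2 hv)
  have h := Finset.card_le_card hsub
  rw [Finset.card_range, Finset.card_map] at h
  have h1 : 1 ≤ n / 2 ^ K := (Nat.one_le_div_iff hpos).2 hK
  have h2 := Nat.div_add_mod n (2 ^ K)
  have h3 := Nat.mod_lt n hpos
  nlinarith

end Counting

/-! ### Blocks of the hypergrid -/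

section Blocks

variable {n d L : ℕ}

/-- The information that the block of level `(a, K)` retains about the `j`-th coordinate `u`: all of
it for `j > a`, the position up to blocks of length `2 ^ K` for `j = a`, nothing for `j < a`. The
value `a = d` is allowed and gives a single block. -/
def coordLabel (a K j u : ℕ) : ℕ := if j < a then 0 else if j = a then u / 2 ^ K else u

/-- The label of the block of level `(a, K)` containing `x`. -/
def blockLabel (a K : ℕ) (x : Hypergrid n d) : Fin d → ℕ := fun j => coordLabel a K j (x j)

/-- The block of `x` is not cut off by the boundary of the grid. -/
def IsFull (a K : ℕ) (x : Hypergrid n d) : Prop :=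
  ∀ j : Fin d, (j : ℕ) = a → (x j / 2 ^ K + 1 : ℕ) * 2 ^ K ≤ n

/-- The possible `j`-th coordinates of the points in the block of `z`. -/
def blockSide (a K : ℕ) (z : Hypergrid n d) (j : Fin d) : Finset (Fin n) :=
  Finset.univ.filter fun u : Fin n => coordLabel a K j u = coordLabel a K j (z j)

lemma mem_piFinset_blockSide {a K : ℕ} {z x : Hypergrid n d} :
    x ∈ Fintype.piFinset (blockSide a K z) ↔ blockLabel a K x = blockLabel a K z := by
  simp [blockSide, blockLabel, funext_iff]

/-- Points whose codes agree from bit `L * a + K` on lie in the same block of level `(a, K)`. -/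
lemma blockLabel_eq_of_code (hL : n ≤ 2 ^ L) {a K : ℕ} (hK : K ≤ L) {x y : Hypergrid n d} {t : ℕ}
    (ht : t ≤ L * a + K) (h : gridCode L x / 2 ^ t = gridCode L y / 2 ^ t) :
    blockLabel a K x = blockLabel a K y := by
  funext j
  simp only [blockLabel, coordLabel]
  split_ifs with h1 h2
  · rfl
  · have h' := div_two_pow_eq_of_le h ht
    rw [← h2, pow_add, ← Nat.div_div_eq_div_mul, ← Nat.div_div_eq_div_mul] at h'
    rw [← gridCode_digit hL x j, ← gridCode_digit hL y j]
    obtain ⟨r, rfl⟩ := Nat.exists_eq_add_of_le hK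
    rw [pow_add 2 K, Nat.mod_mul_right_div_self, Nat.mod_mul_right_div_self, h']
  · have hle : L * a + K ≤ L * j := by
      have : L * (a + 1) ≤ L * j := Nat.mul_le_mul_left _ (by omega)
      rw [mul_add, mul_one] at this
      omega
    rw [← gridCode_digit hL x j, ← gridCode_digit hL y j,
      div_two_pow_eq_of_le h (ht.trans hle)]

lemma prod_block_sides {a K : ℕ} (ha : a ≤ d) (haK : a = d → K = 0) :
    ∏ j : Fin d, (if (j : ℕ) < a then n else if (j : ℕ) = a then 2 ^ K else 1) = n ^ a * 2 ^ K := by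
  rw [Fin.prod_univ_eq_prod_range (fun j => if j < a then n else if j = a then 2 ^ K else 1) d]
  have hlow : ∏ j ∈ Finset.range a, (if j < a then n else if j = a then 2 ^ K else 1) = n ^ a := by
    rw [Finset.prod_congr rfl fun j hj => if_pos (Finset.mem_range.1 hj)]
    simp
  rcases ha.lt_or_eq with h | rfl
  · rw [← Finset.prod_subset (Finset.range_mono h), Finset.prod_range_succ, hlow]
    · simp
    · intro j _ hj
      simp only [Finset.mem_range] at hj
      rw [if_neg (by omega), if_neg (by omega)]
  · rw [hlow, haK rfl]
    simp

lemma card_piFinset_blockSide {a K : ℕ} (ha : a ≤ d) (haK : a = d → K = 0) {z : Hypergrid n d}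
    (hz : IsFull a K z) : (Fintype.piFinset (blockSide a K z)).card = n ^ a * 2 ^ K := by
  rw [Fintype.card_piFinset, ← prod_block_sides ha haK]
  refine Finset.prod_congr rfl fun j _ => ?_
  simp only [blockSide, coordLabel]
  split_ifs with h1 h2
  · simp
  · exact card_block (hz j h2)
  · rw [Finset.card_eq_one]
    refine ⟨z j, ?_⟩
    ext u
    simp [Fin.ext_iff]

/-- The full blocks cover at least half of the grid. -/
lemma card_le_two_mul_card_isFull {a K : ℕ} (hK : 2 ^ K ≤ n)
    [DecidablePred (IsFull a K : Hypergrid n d → Prop)] :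
    Fintype.card (Hypergrid n d) ≤
      2 * (Finset.univ.filter (IsFull a K : Hypergrid n d → Prop)).card := by
  by_cases ha : a < d
  · have h := card_piFinset_le_mul_filter (fun _ : Fin d => (Finset.univ : Finset (Fin n))) ⟨a, ha⟩
      (fun u => (u / 2 ^ K + 1 : ℕ) * 2 ^ K ≤ n) (c := 2) (by simpa using le_two_mul_card_full hK)
    rw [Fintype.piFinset_univ] at h
    refine h.trans (Nat.mul_le_mul_left _ (Finset.card_le_card fun x hx => ?_))
    simp only [Finset.mem_filter, Finset.mem_univ, true_and] at hx ⊢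
    intro j hj
    have : j = ⟨a, ha⟩ := Fin.ext hj
    subst this
    exact hx
  · have : Finset.univ.filter (IsFull a K : Hypergrid n d → Prop) = Finset.univ :=
      Finset.filter_true_of_mem fun x _ j hj => absurd j.2 (by omega)
    rw [this, Finset.card_univ]
    omega

/-- At least a quarter of the points of a full block, and at least half of them if `n = 2`, are lower
endpoints of pairs at a given level below the level of the block. The constant for `n = 2` matters
when `ε` is close to `1 / 4`: it keeps the block smaller than the whole grid. -/
lemma block_le_mul_card_isLower {a K k : ℕ} (ha : a ≤ d) (haK : a = d → K = 0)
    {z : Hypergrid n d} (hz : IsFull a K z) {i : Fin d} (hk : 2 ^ (k + 1) ≤ n)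
    (hi : (i : ℕ) < a ∨ (i : ℕ) = a ∧ k < K) :
    n ^ a * 2 ^ K ≤ (if n = 2 then 2 else 4) * ((Fintype.piFinset (blockSide a K z)).filter
      fun x => IsLower (2 ^ k) (x i)).card := by
  rw [← card_piFinset_blockSide ha haK hz]
  refine card_piFinset_le_mul_filter _ i (IsLower (2 ^ k)) ?_
  have hpos : 0 < 2 ^ k := by positivity
  rcases hi with hi | ⟨hi, hkK⟩
  · have hside : blockSide a K z i = Finset.univ := by
      simp [blockSide, coordLabel, hi]
    rw [hside, Finset.card_univ, Fintype.card_fin]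
    have := le_two_mul_card_isLower_add (n := n) hpos
    rw [pow_succ] at hk
    split_ifs <;> omega
  · have hside : blockSide a K z i =
        Finset.univ.filter fun u : Fin n => (u / 2 ^ K : ℕ) = z i / 2 ^ K := by
      simp [blockSide, coordLabel, hi]
    rw [hside]
    refine (card_block_le_two_mul_isLower hkK (hz i hi)).trans (Nat.mul_le_mul_right _ ?_)
    split_ifs <;> omega

end Blocks

/-! ### Flipped orders are far from unate -/

section Far

variable {n d L : ℕ}

/-- A function increasing along `flipKey` decreases on the pairs at the flipped level in the flipped
block. -/
lemma apply_shiftUp_lt_of_flipKey (hL : n ≤ 2 ^ L) {a K : ℕ} (hK : K ≤ L) {i : Fin d} {k : ℕ}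
    (hk : k < L) (hs : L * i + k + 1 ≤ L * a + K) {f : Hypergrid n d → ℝ} {b : Fin d → ℕ}
    (hf : ∀ x y, flipKey (gridCode L) (blockLabel a K) b (L * i + k) x <
      flipKey (gridCode L) (blockLabel a K) b (L * i + k) y → f x < f y)
    {x : Hypergrid n d} (hx : IsLower (2 ^ k) (x i)) (hb : blockLabel a K x = b) :
    f (shiftUp i (2 ^ k) x) < f x := by
  obtain ⟨h1, h2⟩ := gridCode_shiftUp_bit hL hk hx.2 hx.1
  refine hf _ _ (flipKey_lt_of_isFlipped ?_ ⟨h1, h2, hb, ?_⟩)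
  · rw [gridCode_shiftUp hx.2]
    exact Nat.lt_add_of_pos_right (by positivity)
  · rw [← blockLabel_eq_of_code hL hK hs h1, hb]

/-- A function increasing along `flipKey` increases on the pairs at all other levels and in all
other blocks. -/
lemma lt_apply_shiftUp_of_flipKey (hL : n ≤ 2 ^ L) {a K t : ℕ} (hK : K ≤ L) {i : Fin d} {k : ℕ}
    (hk : k < L) (hs : t + 1 ≤ L * a + K) {f : Hypergrid n d → ℝ} {b : Fin d → ℕ}
    (hf : ∀ x y, flipKey (gridCode L) (blockLabel a K) b t x <
      flipKey (gridCode L) (blockLabel a K) b t y → f x < f y)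
    {x : Hypergrid n d} (hx : IsLower (2 ^ k) (x i))
    (hb : L * i + k ≠ t ∨ blockLabel a K x ≠ b) :
    f x < f (shiftUp i (2 ^ k) x) := by
  obtain ⟨h1, h2⟩ := gridCode_shiftUp_bit hL hk hx.2 hx.1
  refine hf _ _ (flipKey_lt_of_lt ?_ (fun h => blockLabel_eq_of_code hL hK hs h) ?_)
  · rw [gridCode_shiftUp hx.2]
    exact Nat.lt_add_of_pos_right (by positivity)
  · rintro ⟨h3, h4, h5, -⟩
    rcases hb with hb | hb
    · rcases lt_or_gt_of_ne hb with hlt | hlt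
      · exact h4 (div_two_pow_eq_of_le h1 hlt)
      · exact h2 (div_two_pow_eq_of_le h3 hlt)
    · exact hb h5

/-- Flipping one level inside one full block makes the function far from unate. The decreasing pairs
lie in the block. For `n ≥ 3`, the increasing pairs in the same direction are those at another
level in the whole grid; for `n = 2` there is no other level, but there is another block. -/
theorem isFarFromUnate_of_flipKey (hn : 2 ≤ n) {a K : ℕ} (ha : a ≤ d)
    (hK : K ≤ Nat.log 2 n) (haK : a = d → K = 0) {ε : ℝ} (hε : ε ≤ 1 / 4)
    (hsize : (if n = 2 then 2 else 4) * (ε * (n : ℝ) ^ d) ≤ (n : ℝ) ^ a * 2 ^ K)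
    (hsize2 : n = 2 → n ^ a * 2 ^ K < n ^ d) {z : Hypergrid n d} (hz : IsFull a K z)
    {i : Fin d} {k : ℕ} (hk : k < Nat.log 2 n) (hi : (i : ℕ) < a ∨ (i : ℕ) = a ∧ k < K)
    {f : Hypergrid n d → ℝ}
    (hf : ∀ x y, flipKey (gridCode (Nat.log 2 n + 1)) (blockLabel a K) (blockLabel a K z)
        ((Nat.log 2 n + 1) * i + k) x <
      flipKey (gridCode (Nat.log 2 n + 1)) (blockLabel a K) (blockLabel a K z)
        ((Nat.log 2 n + 1) * i + k) y → f x < f y) : IsFarFromUnate ε f := by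
  set L := Nat.log 2 n + 1 with hLdef
  have hL : n ≤ 2 ^ L := (Nat.lt_pow_succ_log_self one_lt_two n).le
  have hs : L * i + k + 1 ≤ L * a + K := by
    rcases hi with hi | ⟨hi, hkK⟩
    · have : L * (i + 1) ≤ L * a := Nat.mul_le_mul_left _ hi
      rw [mul_add, mul_one] at this
      omega
    · rw [hi]; omega
  have hkn : 2 ^ (k + 1) ≤ n :=
    (Nat.pow_le_pow_right two_pos hk).trans (Nat.pow_log_le_self 2 (by omega))
  have hcardX : (Fintype.card (Hypergrid n d) : ℝ) = (n : ℝ) ^ d := by simp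
  have hblock : ∀ z : Hypergrid n d, IsFull a K z →
      ε * Fintype.card (Hypergrid n d) ≤ (((Fintype.piFinset (blockSide a K z)).filter
        fun x => IsLower (2 ^ k) (x i)).card : ℝ) := by
    intro z hz
    have h := block_le_mul_card_isLower ha haK hz hkn hi
    have h' : (n : ℝ) ^ a * 2 ^ K ≤ (if n = 2 then 2 else 4) *
        (((Fintype.piFinset (blockSide a K z)).filter fun x => IsLower (2 ^ k) (x i)).card : ℝ) := by
      exact_mod_cast h
    have h'' := hsize.trans h'
    rw [hcardX]
    split_ifs at h'' <;> linarith
  have hdec : ∀ x ∈ (Fintype.piFinset (blockSide a K z)).filter fun x => IsLower (2 ^ k) (x i),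
      f (shiftUp i (2 ^ k) x) < f x := by
    intro x hx
    rw [Finset.mem_filter, mem_piFinset_blockSide] at hx
    exact apply_shiftUp_lt_of_flipKey hL (by omega) (by omega) hs hf hx.2 hx.1
  rcases hn.eq_or_lt with h2 | h3
  · -- Every block is full when `n = 2`, and there is a second one.
    have hne : ∃ z', z' ∉ Fintype.piFinset (blockSide a K z) := by
      by_contra! hall
      have hcard := card_piFinset_blockSide ha haK hz
      rw [Finset.eq_univ_iff_forall.2 hall, Finset.card_univ] at hcard
      have := hsize2 h2.symm
      simp at hcard
      omega
    obtain ⟨z', hz'⟩ := hne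
    rw [mem_piFinset_blockSide] at hz'
    have hfull : IsFull a K z' := by
      intro j _
      have hdvd : 2 ^ K ∣ n := by
        have : K ≤ 1 := by
          rw [← h2] at hK
          exact hK.trans (by norm_num)
        rw [← h2]
        exact pow_dvd_pow 2 this
      obtain ⟨r, hr⟩ := hdvd
      rw [mul_comm] at hr
      have := (Nat.div_lt_iff_lt_mul (k := 2 ^ K) (by positivity)).2 ((z' j).2.trans_eq hr)
      calc _ ≤ r * 2 ^ K := Nat.mul_le_mul_right _ this
        _ = n := hr.symm
    refine isFarFromUnate_of_pairs (by positivity) (by positivity)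
      (fun x hx => (Finset.mem_filter.1 hx).2) (fun x hx => (Finset.mem_filter.1 hx).2) hdec ?_
      (hblock z hz) (hblock z' hfull)
    intro x hx
    rw [Finset.mem_filter, mem_piFinset_blockSide] at hx
    exact lt_apply_shiftUp_of_flipKey hL (by omega) (by omega) hs hf hx.2 (Or.inr (hx.1 ▸ hz'))
  · obtain ⟨k', hk', hne, hle⟩ : ∃ k', k' < L ∧ k' ≠ k ∧ 2 ^ k' ≤ 2 := by
      by_cases hk0 : k = 0
      · exact ⟨1, by omega, by omega, by norm_num⟩
      · exact ⟨0, by omega, by omega, by norm_num⟩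
    refine isFarFromUnate_of_pairs (m' := 2 ^ k')
      (P' := (Fintype.piFinset fun _ : Fin d => (Finset.univ : Finset (Fin n))).filter
        fun x => IsLower (2 ^ k') (x i)) (by positivity) (by positivity)
      (fun x hx => (Finset.mem_filter.1 hx).2) (fun x hx => (Finset.mem_filter.1 hx).2) hdec ?_
      (hblock z hz) ?_
    · intro x hx
      exact lt_apply_shiftUp_of_flipKey hL (by omega) hk' hs hf (Finset.mem_filter.1 hx).2
        (Or.inl (by omega))
    · have h := card_piFinset_le_mul_filter (fun _ : Fin d => (Finset.univ : Finset (Fin n))) i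
        (IsLower (2 ^ k')) (c := 4) ?_
      · rw [Fintype.piFinset_univ, Finset.card_univ] at h
        rw [Fintype.piFinset_univ]
        have h' : (Fintype.card (Hypergrid n d) : ℝ) ≤ 4 * ((Finset.univ.filter
          fun x : Hypergrid n d => IsLower (2 ^ k') (x i)).card : ℝ) := by exact_mod_cast h
        have : ε * Fintype.card (Hypergrid n d) ≤ 1 / 4 * Fintype.card (Hypergrid n d) :=
          mul_le_mul_of_nonneg_right hε (Nat.cast_nonneg _)
        linarith
      · have := le_two_mul_card_isLower_add (n := n) (m := 2 ^ k') (by positivity)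
        rw [Finset.card_univ, Fintype.card_fin]
        omega

end Far

/-! ### The query bound -/

section Bound

variable {n d : ℕ}

/-- The levels inside a block of level `(a, K)`, as bits of the code with digits of `l + 1` bits. The
top bit of each digit is left out. -/
lemma card_levels (l a K : ℕ) (hK : K ≤ l) :
    ((Finset.range ((l + 1) * a + K)).filter fun t => t % (l + 1) ≠ l).card = a * l + K := by
  have h := Finset.card_filter_add_card_filter_not (s := Finset.range ((l + 1) * a + K))
    (fun t => (l + 1) ∣ t + 1)
  rw [Nat.card_multiples, Finset.card_range, Nat.mul_add_div (by omega),
    Nat.div_eq_of_lt (by omega)] at h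
  have hiff : ∀ t, ¬ (l + 1) ∣ t + 1 ↔ t % (l + 1) ≠ l := by
    intro t
    rw [not_iff_not, Nat.dvd_iff_mod_eq_zero, Nat.add_mod]
    have hlt : t % (l + 1) < l + 1 := Nat.mod_lt t (Nat.succ_pos l)
    rcases Nat.eq_zero_or_pos l with rfl | hl
    · omega
    · rw [Nat.mod_eq_of_lt (a := 1) (by omega)]
      constructor
      · intro h
        by_contra hne
        rw [Nat.mod_eq_of_lt (by omega)] at h
        omega
      · intro h
        rw [h, Nat.mod_self]
  simp only [hiff] at h
  have : (l + 1) * a = a * l + a := by ring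
  omega

/-- The query bound for a given level `(a, K)` of blocks: at least `n ^ d / (2 * |block|)` blocks are
full, each contributes `a * log₂ n + K` flipped orders, and a third of their total number bounds the
number of queries from below. -/
theorem card_mul_levels_le_queries (hn : 2 ≤ n) {a K : ℕ} (ha : a ≤ d)
    (hK : K ≤ Nat.log 2 n) (haK : a = d → K = 0) {ε : ℝ} (hε : ε ≤ 1 / 4)
    (hsize : (if n = 2 then 2 else 4) * (ε * (n : ℝ) ^ d) ≤ (n : ℝ) ^ a * 2 ^ K)
    (hsize2 : n = 2 → n ^ a * 2 ^ K < n ^ d)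
    {Ω : Type*} [MeasurableSpace Ω] (μ : Measure Ω) [IsProbabilityMeasure μ]
    {A : RandomizedAlgorithm (Hypergrid n d) Ω} {q : ℕ}
    (hA : IsUnatenessTester ε μ A) (hq : MakesAtMostQueries A q) :
    (n : ℝ) ^ d * (a * Nat.log 2 n + K : ℕ) ≤ 6 * q * ((n : ℝ) ^ a * 2 ^ K) := by
  classical
  set l := Nat.log 2 n with hl
  have hL : n ≤ 2 ^ (l + 1) := (Nat.lt_pow_succ_log_self one_lt_two n).le
  set F : Finset (Hypergrid n d) := Finset.univ.filter (IsFull a K) with hF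
  have hmain := card_mul_card_le_three_mul_queries (E := gridCode (l + 1)) (lab := blockLabel a K)
    μ hq (gridCode_injective hL) (F.image (blockLabel a K))
    ((Finset.range ((l + 1) * a + K)).filter fun t => t % (l + 1) ≠ l) ?_ ?_ ?_
  · rw [card_levels l a K hK] at hmain
    have hfib : F.card ≤ n ^ a * 2 ^ K * (F.image (blockLabel a K)).card := by
      refine Finset.card_le_mul_card_image _ _ fun b hb => ?_
      obtain ⟨z, hz, rfl⟩ := Finset.mem_image.1 hb
      rw [← card_piFinset_blockSide ha haK (Finset.mem_filter.1 hz).2]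
      refine Finset.card_le_card fun x hx => ?_
      exact mem_piFinset_blockSide.2 (Finset.mem_filter.1 hx).2
    have hhalf := card_le_two_mul_card_isFull (a := a) (d := d)
      ((Nat.pow_le_pow_right two_pos hK).trans (Nat.pow_log_le_self 2 (by omega)))
    have hN : (n : ℝ) ^ d ≤
        2 * ((n : ℝ) ^ a * 2 ^ K * (F.image (blockLabel a K)).card) := by
      have := hhalf.trans (Nat.mul_le_mul_left 2 hfib)
      rw [Fintype.card_fun, Fintype.card_fin, Fintype.card_fin] at this
      exact_mod_cast this
    calc (n : ℝ) ^ d * (a * l + K : ℕ)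
        ≤ 2 * ((n : ℝ) ^ a * 2 ^ K * (F.image (blockLabel a K)).card) * (a * l + K : ℕ) :=
          mul_le_mul_of_nonneg_right hN (Nat.cast_nonneg _)
      _ = 2 * ((n : ℝ) ^ a * 2 ^ K) * ((F.image (blockLabel a K)).card * (a * l + K : ℕ)) := by ring
      _ ≤ 2 * ((n : ℝ) ^ a * 2 ^ K) * (3 * q) := mul_le_mul_of_nonneg_left hmain (by positivity)
      _ = _ := by ring
  · intro t ht x y hxy
    have ht := Finset.mem_range.1 (Finset.mem_filter.1 ht).1
    exact blockLabel_eq_of_code hL (by omega) (by omega) hxy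
  · exact fun f hf => hA.1 f (isUnate_of_gridCode hL hf)
  · intro b hb t ht f hf
    obtain ⟨z, hz, rfl⟩ := Finset.mem_image.1 hb
    obtain ⟨ht, htl⟩ := Finset.mem_filter.1 ht
    rw [Finset.mem_range] at ht
    have hlt : t % (l + 1) < l + 1 := Nat.mod_lt t (Nat.succ_pos l)
    have hdm := Nat.div_add_mod t (l + 1)
    have hi : t / (l + 1) < a ∨ t / (l + 1) = a ∧ t % (l + 1) < K := by
      rcases lt_trichotomy (t / (l + 1)) a with h | h | h
      · exact Or.inl h
      · rw [h] at hdm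
        exact Or.inr ⟨h, by omega⟩
      · have : (l + 1) * (a + 1) ≤ (l + 1) * (t / (l + 1)) := Nat.mul_le_mul_left _ h
        rw [mul_add (l + 1) a] at this
        omega
    have hid : t / (l + 1) < d := by
      rcases hi with h | ⟨h, h'⟩
      · omega
      · have : a ≠ d := fun e => by have := haK e; omega
        omega
    rw [← hdm] at hf
    exact hA.2 f (isFarFromUnate_of_flipKey (i := ⟨t / (l + 1), hid⟩) hn ha hK haK hε hsize hsize2
      (Finset.mem_filter.1 hz).2 (by omega) hi hf)

/-- The possible block sizes are dense up to a factor of two. -/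
lemma exists_block_size (hn : 2 ≤ n) {M : ℝ} (h1 : 1 < M) (hM : M ≤ (n : ℝ) ^ d) :
    ∃ a K : ℕ, a ≤ d ∧ K ≤ Nat.log 2 n ∧ (a = d → K = 0) ∧
      M ≤ (n : ℝ) ^ a * 2 ^ K ∧ (n : ℝ) ^ a * 2 ^ K < 2 * M := by
  classical
  have hd : d ≠ 0 := by
    rintro rfl
    rw [pow_zero] at hM
    linarith
  have hex : ∃ a : ℕ, M ≤ (n : ℝ) ^ (a + 1) := ⟨d - 1, by rwa [Nat.sub_add_cancel (by omega)]⟩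
  obtain ⟨a, had, hup, hlow⟩ : ∃ a : ℕ, a < d ∧ M ≤ (n : ℝ) ^ (a + 1) ∧ (n : ℝ) ^ a < M := by
    refine ⟨Nat.find hex, ?_, Nat.find_spec hex, ?_⟩
    · have : Nat.find hex ≤ d - 1 :=
        Nat.find_min' hex (by rwa [Nat.sub_add_cancel (by omega)])
      omega
    · rcases h : Nat.find hex with _ | r
      · simpa using h1
      · exact not_le.1 (Nat.find_min hex (m := r) (by omega))
  by_cases hl : M ≤ (n : ℝ) ^ a * 2 ^ Nat.log 2 n
  · have hexK : ∃ K : ℕ, M ≤ (n : ℝ) ^ a * 2 ^ K := ⟨_, hl⟩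
    refine ⟨a, Nat.find hexK, had.le, Nat.find_min' hexK hl, fun e => absurd e had.ne,
      Nat.find_spec hexK, ?_⟩
    rcases h : Nat.find hexK with _ | r
    · rw [pow_zero, mul_one]; linarith
    · have := not_le.1 (Nat.find_min hexK (m := r) (by omega))
      rw [pow_succ]
      linarith
  · refine ⟨a + 1, 0, had, Nat.zero_le _, fun _ => rfl, by simpa using hup, ?_⟩
    have hlt : (n : ℝ) < 2 ^ (Nat.log 2 n + 1) := by
      exact_mod_cast Nat.lt_pow_succ_log_self one_lt_two n
    calc (n : ℝ) ^ (a + 1) * 2 ^ 0 = (n : ℝ) ^ a * n := by ring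
      _ ≤ (n : ℝ) ^ a * 2 ^ (Nat.log 2 n + 1) := mul_le_mul_of_nonneg_left hlt.le (by positivity)
      _ = 2 * ((n : ℝ) ^ a * 2 ^ Nat.log 2 n) := by ring
      _ < 2 * M := by linarith

/-- The number of levels inside a block is at least proportional to the logarithm of its size. -/
lemma log_block_size_le (hn : 2 ≤ n) (a K : ℕ) :
    Real.log ((n : ℝ) ^ a * 2 ^ K) ≤ 2 * (a * Nat.log 2 n + K : ℕ) := by
  have hl : 1 ≤ Nat.log 2 n := Nat.log_pos one_lt_two hn
  have hle : n ≤ 2 ^ (2 * Nat.log 2 n) :=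
    (Nat.lt_pow_succ_log_self one_lt_two n).le.trans (Nat.pow_le_pow_right two_pos (by omega))
  have hpow : n ^ a * 2 ^ K ≤ 2 ^ (2 * (a * Nat.log 2 n + K)) := by
    calc n ^ a * 2 ^ K ≤ (2 ^ (2 * Nat.log 2 n)) ^ a * 2 ^ (2 * K) :=
          Nat.mul_le_mul (Nat.pow_le_pow_left hle a) (Nat.pow_le_pow_right two_pos (by omega))
      _ = _ := by rw [← pow_mul, ← pow_add]; congr 1; ring
  have hpow' : (n : ℝ) ^ a * 2 ^ K ≤ 2 ^ (2 * (a * Nat.log 2 n + K)) := by exact_mod_cast hpow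
  have hn0 : (0 : ℝ) < n := by exact_mod_cast (by omega : 0 < n)
  calc Real.log ((n : ℝ) ^ a * 2 ^ K)
      ≤ Real.log (2 ^ (2 * (a * Nat.log 2 n + K))) := Real.log_le_log (by positivity) hpow'
    _ = (2 * (a * Nat.log 2 n + K) : ℕ) * Real.log 2 := Real.log_pow _ _
    _ ≤ (2 * (a * Nat.log 2 n + K) : ℕ) * 1 :=
        mul_le_mul_of_nonneg_left (by linarith [Real.log_two_lt_d9]) (Nat.cast_nonneg _)
    _ = _ := by push_cast; ring

end Bound

theorem theorem3 :
    ∃ c : ℝ, 0 < c ∧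
      ∀ (n d : ℕ), 0 < n → 0 < d → ∀ ε : ℝ, 0 < ε → ε < 1 / 4 →
        ∀ (Ω : Type*) [MeasurableSpace Ω] (μ : Measure Ω) [IsProbabilityMeasure μ]
          (A : RandomizedAlgorithm (Hypergrid n d) Ω) (q : ℕ),
          IsUnatenessTester ε μ A → MakesAtMostQueries A q →
            c * ((d : ℝ) * Real.log n / ε - Real.log (1 / ε) / ε) ≤ (q : ℝ) := by
  refine ⟨1 / 96, by norm_num, ?_⟩
  intro n d hn hd ε hε hε4 Ω _ μ _ A q hA hq
  have hn0 : (0 : ℝ) < n := by exact_mod_cast hn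
  have hq0 : (0 : ℝ) ≤ q := Nat.cast_nonneg q
  have hRHS : (d : ℝ) * Real.log n / ε - Real.log (1 / ε) / ε = Real.log (ε * (n : ℝ) ^ d) / ε := by
    rw [Real.log_mul hε.ne' (by positivity), Real.log_pow, one_div, Real.log_inv]
    ring
  rw [hRHS]
  -- If `ε * n ^ d ≤ 1`, the claimed bound is not positive.
  rcases le_or_gt (ε * (n : ℝ) ^ d) 1 with h1 | h1
  · have := div_nonpos_of_nonpos_of_nonneg (Real.log_nonpos (by positivity) h1) hε.le
    linarith
  have hn2 : 2 ≤ n := by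
    by_contra hlt
    have : n = 1 := by omega
    subst this
    simp at h1
    linarith
  -- `C` is the inverse of the proportion of a block that decreasing pairs are guaranteed to fill.
  set C : ℝ := if n = 2 then 2 else 4 with hC
  have hC2 : 2 ≤ C := by rw [hC]; split_ifs <;> norm_num
  have hC4 : C ≤ 4 := by rw [hC]; split_ifs <;> norm_num
  have hpow : (0 : ℝ) < (n : ℝ) ^ d := by positivity
  obtain ⟨a, K, ha, hK, haK, hlow, hup⟩ := exists_block_size (d := d) hn2
    (M := C * (ε * (n : ℝ) ^ d)) (by nlinarith) (by nlinarith [mul_pos hε hpow])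
  have hsize2 : n = 2 → n ^ a * 2 ^ K < n ^ d := by
    intro h2
    rw [hC, if_pos h2] at hup
    have : (n : ℝ) ^ a * 2 ^ K < (n : ℝ) ^ d := by nlinarith
    exact_mod_cast this
  have hmain := card_mul_levels_le_queries hn2 ha hK haK hε4.le hlow hsize2 μ hA hq
  have hlog : Real.log (ε * (n : ℝ) ^ d) ≤ 2 * (a * Nat.log 2 n + K : ℕ) :=
    (Real.log_le_log (by positivity) (by nlinarith)).trans (log_block_size_le hn2 a K)
  have hsize : (n : ℝ) ^ a * 2 ^ K ≤ 8 * (ε * (n : ℝ) ^ d) := by nlinarith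
  have hlev : ((a * Nat.log 2 n + K : ℕ) : ℝ) ≤ 48 * q * ε := by
    refine le_of_mul_le_mul_left (hmain.trans ?_) hpow
    calc 6 * (q : ℝ) * ((n : ℝ) ^ a * 2 ^ K) ≤ 6 * q * (8 * (ε * (n : ℝ) ^ d)) :=
          mul_le_mul_of_nonneg_left hsize (by positivity)
      _ = _ := by ring
  have : Real.log (ε * (n : ℝ) ^ d) / ε ≤ 96 * q := by
    rw [div_le_iff₀ hε]
    linarith
  linarith
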